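/- For a prime power $q$ and a field $\mathbb F_q$ with $q$ elements, let $\mathrm{AGL}(2,\mathbb F_q)$ be the group of all affine transformations $(A,b)\colon x\mapsto Ax+b$ of $\mathbb F_q^2$, where $A\in\mathrm{GL}(2,\mathbb F_q)$ and $b\in\mathbb F_q^2$, under composition, i.e. $(A_1,b_1)\circ(A_2,b_2)=(A_1A_2,\,A_1b_2+b_1)$. Let $e_2=\begin{pmatrix}0\\1\end{pmatrix}$. (1) If $q\ge 3$, then $\mathrm{AGL}(2,\mathbb F_q)$ is generated by two elements. More precisely, let $\alpha$ be any generator of the multiplicative group $\mathbb F_q^\times$ and let $\beta$ be any generator of the multiplicative group of a quadratic extension $\mathbb F_{q^2}$ of $\mathbb F_q$. Then $\beta+\beta^q\in\mathbb F_q$, and $\mathrm{AGL}(2,\mathbb F_q)$ is generated by the two elements $$\left(\begin{pmatrix}0&-\alpha\\1&\beta+\beta^q\end{pmatrix},\,0\right)\quad\text{and}\quad\left(\begin{pmatrix}\alpha&0\\0&1\end{pmatrix},\,e_2\right).$$ (2) If $q=2$, then $\mathrm{AGL}(2,\mathbb F_2)$ is generated by the two elements $$\left(\begin{pmatrix}0&1\\1&1\end{pmatrix},\,\begin{pmatrix}0\\0\end{pmatrix}\right)\quad\text{and}\quad\left(\begin{pmatrix}1&1\\0&1\end{pmatrix},\,\begin{pmatrix}1\\0\end{pmatrix}\right).$$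 -/

import Mathlib

open scoped Matrix

/-- The affine group `AGL(n, F)`: the bijective affine transformations of `F^n`, with composition
as the group operation. -/
abbrev AGL (n : ℕ) (F : Type*) [Field F] : Type _ :=
  (Fin n → F) ≃ᵃ[F] (Fin n → F)

namespace AGL

variable {n : ℕ} {F : Type*} [Field F]

/-- The element `(A, b)` of `AGL(n, F)`, i.e. the transformation `x ↦ A x + b`. -/
def ofPair (A : GL (Fin n) F) (b : Fin n → F) : AGL n F :=
  (Matrix.toLin'OfInv (M := ((A⁻¹ : GL (Fin n) F) : Matrix (Fin n) (Fin n) F))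
    (M' := (A : Matrix (Fin n) (Fin n) F))
    (Units.inv_mul A) (Units.mul_inv A)).toAffineEquiv.trans (AffineEquiv.constVAdd F (Fin n → F) b)

theorem ofPair_apply (A : GL (Fin n) F) (b x : Fin n → F) :
    ofPair A b x = (A : Matrix (Fin n) (Fin n) F) *ᵥ x + b := by
  change b + Matrix.toLin' (A : Matrix (Fin n) (Fin n) F) x = _
  rw [Matrix.toLin'_apply, add_comm]

/-- The group law on pairs: `(A₁, b₁) ∘ (A₂, b₂) = (A₁ A₂, A₁ b₂ + b₁)`. -/
theorem ofPair_mul (A₁ A₂ : GL (Fin n) F) (b₁ b₂ : Fin n → F) :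
    ofPair A₁ b₁ * ofPair A₂ b₂ =
      ofPair (A₁ * A₂) ((A₁ : Matrix (Fin n) (Fin n) F) *ᵥ b₂ + b₁) := by
  ext1 x
  change ofPair A₁ b₁ (ofPair A₂ b₂ x) = _
  simp only [ofPair_apply, Units.val_mul, Matrix.mulVec_add, Matrix.mulVec_mulVec, add_assoc]

end AGL

/-!
A subgroup `S` of `AGL(2, F)` is everything as soon as its linear parts fill `GL(2, F)` and it
contains one nonzero translation: conjugation moves that translation to every other one, because
`GL(2, F)` is transitive on nonzero vectors, and the translations then correct the translation part
of any element (`AGL.eq_top_of_linear_of_translation`). The two conditions are checked separately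
for the given generators.

*Linear parts.* `GL(2, F)` is generated by the transvections together with the matrices
`diag(a, 1)` (`eq_top_of_transvections_mem`). From `A = [0, -α; 1, t]` and `B = diag(α, 1)` one gets
`B⁻¹ A = [0, -1; 1, t]`, and conjugating by powers of `B` gives `C x = [0, -x⁻¹; x, t]` for all
`x ≠ 0`. The product `C x * (C y)⁻¹` is lower triangular with diagonal `y / x, x / y` and
off-diagonal entry `t (x - y)`; quotients of two such matrices with the same diagonal are lower
transvections, and all of them arise if `t ≠ 0` and `F` has at least three elements. Multiplying
`C 1` by a lower transvection produces the Weyl element `[0, -1; 1, 0]`, which conjugates lower to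
upper transvections. Thus only `t ≠ 0` matters (`closure_companion_diag_eq_top`).
For the trace `t = β + β ^ q` of a generator `β` of the quadratic extension this holds since
`β ^ (q - 1) = -1` would force `β` to have order at most `2 (q - 1) < q ^ 2 - 1`.

*Translations.* As `B` fixes `e₂`, the power `(B, e₂) ^ (q - 1)` is the translation by
`(q - 1) e₂ = -e₂`. For `q = 2` the square of the product of the two generators is the translation
by `(1, 1)`.
-/

/-! ### Generation of `GL(2, F)` -/

section Linear

variable {F : Type*} [Field F]

/-- The matrices underlying a subgroup of `GL(n, F)`, as a submonoid of the ring of matrices. It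
allows one to multiply explicit matrices without producing their inverses. -/
def Subgroup.matrices {n : ℕ} (H : Subgroup (GL (Fin n) F)) :
    Submonoid (Matrix (Fin n) (Fin n) F) :=
  H.toSubmonoid.map (Units.coeHom _)

theorem Subgroup.coe_mem_matrices {n : ℕ} {H : Subgroup (GL (Fin n) F)} {g : GL (Fin n) F} :
    (g : Matrix (Fin n) (Fin n) F) ∈ H.matrices ↔ g ∈ H := by
  constructor
  · rintro ⟨g', hg', h⟩
    rwa [← Units.ext (show (g' : Matrix (Fin n) (Fin n) F) = g from h)]
  · exact fun h => ⟨g, h, rfl⟩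

theorem Subgroup.mem_matrices_of_mul_eq_one {n : ℕ} {H : Subgroup (GL (Fin n) F)}
    {M N : Matrix (Fin n) (Fin n) F} (hM : M ∈ H.matrices) (h : M * N = 1) : N ∈ H.matrices := by
  obtain ⟨g, hg, rfl⟩ := hM
  have : N = ((g⁻¹ : GL (Fin n) F) : Matrix (Fin n) (Fin n) F) :=
    Units.eq_inv_of_mul_eq_one_left h
  rw [this]
  exact coe_mem_matrices.2 (H.inv_mem hg)

theorem eq_top_of_transvections_mem {H : Subgroup (GL (Fin 2) F)}
    (hu : ∀ s : F, !![1, s; 0, 1] ∈ H.matrices) (hl : ∀ s : F, !![1, 0; s, 1] ∈ H.matrices)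
    (hd : ∀ a : F, a ≠ 0 → !![a, 0; 0, 1] ∈ H.matrices) : H = ⊤ := by
  -- If `c ≠ 0`, the matrix is, up to `diag(det, 1)`, a product upper-lower-upper.
  have key : ∀ a b c d : F, c ≠ 0 → a * d - b * c ≠ 0 → !![a, b; c, d] ∈ H.matrices := by
    intro a b c d hc hD
    have h := mul_mem (mul_mem (mul_mem (hd _ hD) (hu ((a / (a * d - b * c) - 1) / c))) (hl c))
      (hu ((d - 1) / c))
    convert h using 1
    ext i j
    fin_cases i <;> fin_cases j <;> simp [Matrix.mul_apply, Fin.sum_univ_two] <;> field_simp <;> ring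
  rw [eq_top_iff]
  intro g _
  rw [← Subgroup.coe_mem_matrices]
  have hdet : (g : Matrix (Fin 2) (Fin 2) F).det ≠ 0 := g.det_ne_zero
  rw [Matrix.det_fin_two] at hdet
  rw [Matrix.eta_fin_two (g : Matrix (Fin 2) (Fin 2) F)]
  generalize (g : Matrix (Fin 2) (Fin 2) F) 0 0 = a at *
  generalize (g : Matrix (Fin 2) (Fin 2) F) 0 1 = b at *
  generalize (g : Matrix (Fin 2) (Fin 2) F) 1 0 = c at *
  generalize (g : Matrix (Fin 2) (Fin 2) F) 1 1 = d at *
  by_cases hc : c = 0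
  · subst hc
    have ha : a ≠ 0 := by
      rintro rfl
      simp at hdet
    -- Adding the first row to the second makes the lower left entry nonzero.
    have h := mul_mem (hl (-1)) (key a b a (b + d) ha (by convert hdet using 1; ring))
    convert h using 1
    ext i j
    fin_cases i <;> fin_cases j <;> simp [Matrix.mul_apply, Fin.sum_univ_two]
  · exact key a b c d hc hdet

theorem diag_mem_matrices_of_generator {H : Subgroup (GL (Fin 2) F)} {α : Fˣ}
    [Finite F] (hα : Subgroup.zpowers α = ⊤) (hB : !![(α : F), 0; 0, 1] ∈ H.matrices)
    (a : F) (ha : a ≠ 0) : !![a, 0; 0, 1] ∈ H.matrices := by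
  have hmem : Units.mk0 a ha ∈ Subgroup.zpowers α := hα ▸ Subgroup.mem_top _
  rw [← mem_powers_iff_mem_zpowers] at hmem
  obtain ⟨k, hk⟩ := hmem
  have hk' : (α : F) ^ k = a := by simpa using congrArg Units.val hk
  have h := pow_mem hB k
  have e : ∀ x : F, !![x, 0; 0, 1] = Matrix.diagonal ![x, 1] := by
    intro x
    ext i j
    fin_cases i <;> fin_cases j <;> simp
  rw [e, Matrix.diagonal_pow] at h
  rw [e]
  convert h using 2
  ext i
  fin_cases i <;> simp [hk']

/-- If `t ≠ 0` and `F` has at least three elements, the matrix `[0, -1; 1, t]` and the matrices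
`diag(a, 1)` generate `GL(2, F)`. -/
theorem eq_top_of_companion_mem (hF : 3 ≤ Cardinal.mk F) {t : F} (ht : t ≠ 0)
    {H : Subgroup (GL (Fin 2) F)} (hC : !![0, -1; 1, t] ∈ H.matrices)
    (hd : ∀ a : F, a ≠ 0 → !![a, 0; 0, 1] ∈ H.matrices) : H = ⊤ := by
  have hCx : ∀ x : F, x ≠ 0 → !![0, -x⁻¹; x, t] ∈ H.matrices := by
    intro x hx
    convert mul_mem (mul_mem (hd x⁻¹ (inv_ne_zero hx)) hC) (hd x hx) using 1
    ext i j
    fin_cases i <;> fin_cases j <;> simp [Matrix.mul_apply, Fin.sum_univ_two]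
  have hCinv : ∀ x : F, x ≠ 0 → !![t, x⁻¹; -x, 0] ∈ H.matrices := by
    intro x hx
    refine Subgroup.mem_matrices_of_mul_eq_one (hCx x hx) ?_
    ext i j
    fin_cases i <;> fin_cases j <;> simp [Matrix.mul_apply, Fin.sum_univ_two, hx] <;> ring
  obtain ⟨l, hl0, hl1⟩ := Cardinal.exists_ne_ne_of_three_le hF (0 : F) 1
  -- `C x * (C y)⁻¹` for `y = l * x`, and its inverse `C y * (C x)⁻¹`.
  have hT : ∀ x : F, x ≠ 0 → !![l, 0; t * (1 - l) * x, l⁻¹] ∈ H.matrices := by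
    intro x hx
    convert mul_mem (hCx x hx) (hCinv (l * x) (mul_ne_zero hl0 hx)) using 1
    ext i j
    fin_cases i <;> fin_cases j <;> simp [Matrix.mul_apply, Fin.sum_univ_two] <;> field_simp <;> ring
  have hTinv : ∀ x : F, x ≠ 0 → !![l⁻¹, 0; -(t * (1 - l) * x), l] ∈ H.matrices := by
    intro x hx
    convert mul_mem (hCx (l * x) (mul_ne_zero hl0 hx)) (hCinv x hx) using 1
    ext i j
    fin_cases i <;> fin_cases j <;> simp [Matrix.mul_apply, Fin.sum_univ_two] <;> field_simp <;> ring
  have h1l : 1 - l ≠ 0 := sub_ne_zero.2 hl1.symm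
  have hlow : ∀ s : F, !![1, 0; s, 1] ∈ H.matrices := by
    intro s
    obtain ⟨x, hx0, hxs⟩ := Cardinal.exists_ne_ne_of_three_le hF (0 : F) (s * l / (t * (1 - l)))
    convert mul_mem (hT x hx0) (hTinv _ (sub_ne_zero.2 hxs)) using 1
    ext i j
    fin_cases i <;> fin_cases j <;> simp [Matrix.mul_apply, Fin.sum_univ_two, hl0] <;> field_simp
    ring
  have hW : !![0, -1; 1, 0] ∈ H.matrices := by
    convert mul_mem (hlow t) hC using 1
    ext i j
    fin_cases i <;> fin_cases j <;> simp [Matrix.mul_apply, Fin.sum_univ_two]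
  refine eq_top_of_transvections_mem (fun s => ?_) hlow hd
  -- `w³ = w⁻¹` for the Weyl element `w`.
  convert mul_mem (mul_mem hW (hlow (-s))) (pow_mem hW 3) using 1
  ext i j
  fin_cases i <;> fin_cases j <;> simp [pow_succ, Matrix.mul_apply, Fin.sum_univ_two]

theorem closure_companion_diag_eq_top [Finite F] (hF : 3 ≤ Nat.card F) {t : F} (ht : t ≠ 0)
    {α : Fˣ} (hα : Subgroup.zpowers α = ⊤) {A B : GL (Fin 2) F}
    (hA : (A : Matrix (Fin 2) (Fin 2) F) = !![0, -(α : F); 1, t])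
    (hB : (B : Matrix (Fin 2) (Fin 2) F) = !![(α : F), 0; 0, 1]) :
    Subgroup.closure {A, B} = ⊤ := by
  have hA' : !![0, -(α : F); 1, t] ∈ (Subgroup.closure {A, B}).matrices :=
    hA ▸ Subgroup.coe_mem_matrices.2 (Subgroup.subset_closure (by simp))
  have hB' : !![(α : F), 0; 0, 1] ∈ (Subgroup.closure {A, B}).matrices :=
    hB ▸ Subgroup.coe_mem_matrices.2 (Subgroup.subset_closure (by simp))
  have hd := diag_mem_matrices_of_generator hα hB'
  refine eq_top_of_companion_mem (by rw [← Nat.cast_card]; exact_mod_cast hF) ht ?_ hd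
  convert mul_mem (hd (α : F)⁻¹ (inv_ne_zero α.ne_zero)) hA' using 1
  ext i j
  fin_cases i <;> fin_cases j <;> simp [Matrix.mul_apply, Fin.sum_univ_two]

theorem closure_eq_top_of_card_eq_two (hF : ∀ x : F, x = 0 ∨ x = 1) (h2 : (1 + 1 : F) = 0)
    {A B : GL (Fin 2) F} (hA : (A : Matrix (Fin 2) (Fin 2) F) = !![0, 1; 1, 1])
    (hB : (B : Matrix (Fin 2) (Fin 2) F) = !![1, 1; 0, 1]) :
    Subgroup.closure {A, B} = ⊤ := by
  have hA' : !![0, 1; 1, 1] ∈ (Subgroup.closure {A, B}).matrices :=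
    hA ▸ Subgroup.coe_mem_matrices.2 (Subgroup.subset_closure (by simp))
  have hB' : !![1, 1; 0, 1] ∈ (Subgroup.closure {A, B}).matrices :=
    hB ▸ Subgroup.coe_mem_matrices.2 (Subgroup.subset_closure (by simp))
  have h1 : !![1, 0; 0, 1] ∈ (Subgroup.closure {A, B}).matrices := by
    rw [← Matrix.one_fin_two]
    exact one_mem _
  -- `A * B` is the coordinate swap, so `(A * B) * B * (A * B)` is the lower transvection.
  have hL : !![1, 0; 1, 1] ∈ (Subgroup.closure {A, B}).matrices := by
    convert mul_mem (mul_mem (mul_mem hA' hB') hB') (mul_mem hA' hB') using 1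
    ext i j
    fin_cases i <;> fin_cases j <;> simp [Matrix.mul_apply, Fin.sum_univ_two, h2]
  refine eq_top_of_transvections_mem (fun s => ?_) (fun s => ?_) (fun a ha => ?_)
  · rcases hF s with rfl | rfl
    exacts [h1, hB']
  · rcases hF s with rfl | rfl
    exacts [h1, hL]
  · rcases hF a with rfl | rfl
    exacts [absurd rfl ha, h1]

end Linear

/-! ### From linear parts to the affine group -/

namespace AGL

variable {F : Type*} [Field F]

theorem exists_eq_ofPair {n : ℕ} (g : AGL n F) : ∃ A b, g = ofPair A b := by
  refine ⟨Matrix.GeneralLinearGroup.toLin.symm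
    ((LinearMap.GeneralLinearGroup.generalLinearEquiv F (Fin n → F)).symm g.linear), g 0, ?_⟩
  ext1 x
  rw [ofPair_apply, ← Matrix.toLin'_apply]
  have h : Matrix.toLin' ((Matrix.GeneralLinearGroup.toLin.symm
      ((LinearMap.GeneralLinearGroup.generalLinearEquiv F (Fin n → F)).symm g.linear) :
        GL (Fin n) F) : Matrix (Fin n) (Fin n) F) = (g.linear : (Fin n → F) →ₗ[F] (Fin n → F)) := by
    change ((Matrix.GeneralLinearGroup.toLin (Matrix.GeneralLinearGroup.toLin.symm _) :
      LinearMap.GeneralLinearGroup F (Fin n → F)) : (Fin n → F) →ₗ[F] (Fin n → F)) = _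
    rw [MulEquiv.apply_symm_apply]
    rfl
  rw [h]
  simpa using g.map_vadd 0 x

theorem ofPair_one_zero {n : ℕ} : ofPair (1 : GL (Fin n) F) 0 = 1 := by
  ext1 x
  simp [ofPair_apply]

theorem ofPair_inv {n : ℕ} (A : GL (Fin n) F) (b : Fin n → F) :
    (ofPair A b)⁻¹ = ofPair A⁻¹ (-(((A⁻¹ : GL (Fin n) F) : Matrix (Fin n) (Fin n) F) *ᵥ b)) := by
  rw [inv_eq_iff_mul_eq_one, ofPair_mul, mul_inv_cancel, Matrix.mulVec_neg, Matrix.mulVec_mulVec,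
    Units.mul_inv, Matrix.one_mulVec, neg_add_cancel, ofPair_one_zero]

/-- Conjugating the translation by `v` by an element with linear part `A` gives the translation
by `A v`. -/
theorem ofPair_conj_translation {n : ℕ} (A : GL (Fin n) F) (b v : Fin n → F) :
    ofPair A b * ofPair 1 v * (ofPair A b)⁻¹ =
      ofPair 1 ((A : Matrix (Fin n) (Fin n) F) *ᵥ v) := by
  rw [mul_inv_eq_iff_eq_mul, ofPair_mul, ofPair_mul]
  simp [add_comm]

theorem exists_GL_mulVec_eq {v w : Fin 2 → F} (hv : v ≠ 0) (hw : w ≠ 0) :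
    ∃ A : GL (Fin 2) F, (A : Matrix (Fin 2) (Fin 2) F) *ᵥ v = w := by
  have key : ∀ u : Fin 2 → F, u ≠ 0 →
      ∃ A : GL (Fin 2) F, (A : Matrix (Fin 2) (Fin 2) F) *ᵥ ![1, 0] = u := by
    intro u hu
    by_cases h0 : u 0 = 0
    · have h1 : u 1 ≠ 0 := by
        intro h1
        apply hu
        ext i
        fin_cases i <;> simp [h0, h1]
      refine ⟨Matrix.GeneralLinearGroup.mkOfDetNeZero !![u 0, 1; u 1, 0]
        (by simpa [Matrix.det_fin_two] using h1), ?_⟩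
      ext i
      fin_cases i <;> simp [Matrix.GeneralLinearGroup.mkOfDetNeZero, Matrix.mulVec, dotProduct]
    · refine ⟨Matrix.GeneralLinearGroup.mkOfDetNeZero !![u 0, 0; u 1, 1]
        (by simpa [Matrix.det_fin_two] using h0), ?_⟩
      ext i
      fin_cases i <;> simp [Matrix.GeneralLinearGroup.mkOfDetNeZero, Matrix.mulVec, dotProduct]
  obtain ⟨P, hP⟩ := key v hv
  obtain ⟨Q, hQ⟩ := key w hw
  refine ⟨Q * P⁻¹, ?_⟩
  rw [← hP, Matrix.mulVec_mulVec, ← Units.val_mul, inv_mul_cancel_right, hQ]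

/-- A subgroup of `AGL(2, F)` whose linear parts are all of `GL(2, F)` and which contains a nonzero
translation is the whole group. The translation part `b` may depend on `A`: it is removed by
translations. -/
theorem eq_top_of_linear_of_translation {S : Subgroup (AGL 2 F)}
    (hlin : ∀ A : GL (Fin 2) F, ∃ b, ofPair A b ∈ S) {v : Fin 2 → F} (hv : v ≠ 0)
    (hvS : ofPair 1 v ∈ S) : S = ⊤ := by
  have htrans : ∀ w : Fin 2 → F, ofPair 1 w ∈ S := by
    intro w
    by_cases hw : w = 0
    · rw [hw, ofPair_one_zero]
      exact S.one_mem
    · obtain ⟨A, rfl⟩ := exists_GL_mulVec_eq hv hw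
      obtain ⟨b, hb⟩ := hlin A
      rw [← ofPair_conj_translation A b]
      exact S.mul_mem (S.mul_mem hb hvS) (S.inv_mem hb)
  rw [eq_top_iff]
  intro g _
  obtain ⟨A, b, rfl⟩ := exists_eq_ofPair g
  obtain ⟨c, hc⟩ := hlin A
  have h := S.mul_mem (htrans (b - c)) hc
  rwa [ofPair_mul, one_mul, Units.val_one, Matrix.one_mulVec, add_sub_cancel] at h

theorem exists_ofPair_mem_closure {n : ℕ} {A B : GL (Fin n) F} (a b : Fin n → F)
    (h : Subgroup.closure {A, B} = ⊤) (M : GL (Fin n) F) :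
    ∃ c, ofPair M c ∈ Subgroup.closure {ofPair A a, ofPair B b} := by
  have hM : M ∈ Subgroup.closure {A, B} := h ▸ Subgroup.mem_top M
  induction hM using Subgroup.closure_induction with
  | mem x hx =>
    rcases hx with rfl | rfl
    · exact ⟨a, Subgroup.subset_closure (by simp)⟩
    · exact ⟨b, Subgroup.subset_closure (by simp)⟩
  | one => exact ⟨0, ofPair_one_zero (F := F) ▸ Subgroup.one_mem _⟩
  | mul x y _ _ hx hy =>
    obtain ⟨c, hc⟩ := hx
    obtain ⟨d, hd⟩ := hy
    exact ⟨_, ofPair_mul x y c d ▸ Subgroup.mul_mem _ hc hd⟩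
  | inv x _ hx =>
    obtain ⟨c, hc⟩ := hx
    exact ⟨_, ofPair_inv x c ▸ Subgroup.inv_mem _ hc⟩

theorem ofPair_pow_of_mulVec_eq {n : ℕ} {B : GL (Fin n) F} {v : Fin n → F}
    (h : (B : Matrix (Fin n) (Fin n) F) *ᵥ v = v) (k : ℕ) :
    ofPair B v ^ k = ofPair (B ^ k) ((k : F) • v) := by
  induction k with
  | zero => simp [ofPair_one_zero]
  | succ k ih =>
    have hk : ∀ k : ℕ, ((B ^ k : GL (Fin n) F) : Matrix (Fin n) (Fin n) F) *ᵥ v = v := by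
      intro k
      induction k with
      | zero => simp
      | succ k ih => rw [pow_succ, Units.val_mul, ← Matrix.mulVec_mulVec, h, ih]
    rw [pow_succ, ih, ofPair_mul, hk, pow_succ, Nat.cast_succ, add_smul, one_smul, add_comm]

theorem closure_companion_diag_eq_top [Finite F] (hF : 3 ≤ Nat.card F) {t : F} (ht : t ≠ 0)
    {α : Fˣ} (hα : Subgroup.zpowers α = ⊤) {A B : GL (Fin 2) F}
    (hA : (A : Matrix (Fin 2) (Fin 2) F) = !![0, -(α : F); 1, t])
    (hB : (B : Matrix (Fin 2) (Fin 2) F) = !![(α : F), 0; 0, 1]) :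
    Subgroup.closure {ofPair A 0, ofPair B ![0, 1]} = ⊤ := by
  have := Fintype.ofFinite F
  refine eq_top_of_linear_of_translation (v := ((Nat.card F - 1 : ℕ) : F) • ![0, 1])
    (exists_ofPair_mem_closure _ _ (_root_.closure_companion_diag_eq_top hF ht hα hA hB)) ?_ ?_
  · intro h
    -- The second coordinate is `q - 1`, which is `-1` in `F`.
    have h1 := congrFun h 1
    rw [Nat.cast_sub (by omega), Nat.card_eq_fintype_card, FiniteField.cast_card_eq_zero] at h1
    simp at h1
  · have hfix : (B : Matrix (Fin 2) (Fin 2) F) *ᵥ ![0, 1] = ![0, 1] := by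
      rw [hB]
      ext i
      fin_cases i <;> simp
    have hpow : B ^ (Nat.card F - 1) = 1 := by
      have e : (B : Matrix (Fin 2) (Fin 2) F) = Matrix.diagonal ![(α : F), 1] := by
        rw [hB]
        ext i j
        fin_cases i <;> fin_cases j <;> simp
      apply Units.ext
      rw [Units.val_pow_eq_pow_val, e, Matrix.diagonal_pow, Units.val_one,
        ← Matrix.diagonal_one]
      congr 1
      ext i
      fin_cases i
      · simpa [Nat.card_eq_fintype_card] using FiniteField.pow_card_sub_one_eq_one _ α.ne_zero
      · simp
    have h := ofPair_pow_of_mulVec_eq hfix (Nat.card F - 1)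
    rw [hpow] at h
    rw [← h]
    exact pow_mem (Subgroup.subset_closure (by simp)) _

theorem closure_eq_top_of_card_eq_two (hF : Nat.card F = 2) {A B : GL (Fin 2) F}
    (hA : (A : Matrix (Fin 2) (Fin 2) F) = !![0, 1; 1, 1])
    (hB : (B : Matrix (Fin 2) (Fin 2) F) = !![1, 1; 0, 1]) :
    Subgroup.closure {ofPair A 0, ofPair B ![1, 0]} = ⊤ := by
  have : Finite F := Nat.finite_of_card_ne_zero (by omega)
  have := Fintype.ofFinite F
  have h2 : (1 + 1 : F) = 0 := by
    have h := FiniteField.cast_card_eq_zero F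
    rw [← Nat.card_eq_fintype_card, hF] at h
    rw [one_add_one_eq_two]
    exact_mod_cast h
  have h01 : ∀ x : F, x = 0 ∨ x = 1 := by
    intro x
    by_contra! hx
    have h3 : 2 < Fintype.card F :=
      Fintype.two_lt_card_iff.2 ⟨x, 0, 1, hx.1, hx.2, zero_ne_one⟩
    rw [← Nat.card_eq_fintype_card, hF] at h3
    exact lt_irrefl _ h3
  refine eq_top_of_linear_of_translation (v := ![1, 1])
    (exists_ofPair_mem_closure _ _ (_root_.closure_eq_top_of_card_eq_two h01 h2 hA hB)) ?_ ?_
  · intro h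
    simpa using congrFun h 0
  · have hgA : ofPair A 0 ∈ Subgroup.closure {ofPair A 0, ofPair B ![1, 0]} :=
      Subgroup.subset_closure (by simp)
    have hgB : ofPair B ![1, 0] ∈ Subgroup.closure {ofPair A 0, ofPair B ![1, 0]} :=
      Subgroup.subset_closure (by simp)
    -- The linear part of the product is the swap, so its square is a translation.
    have h := mul_mem (mul_mem hgA hgB) (mul_mem hgA hgB)
    rw [ofPair_mul, ofPair_mul] at h
    convert h using 2
    · apply Units.ext
      simp only [Units.val_mul, hA, hB]
      ext i j
      fin_cases i <;> fin_cases j <;> simp [Matrix.mul_apply, Fin.sum_univ_two, h2]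
    · simp only [Units.val_mul, hA, hB]
      ext i
      fin_cases i <;> simp [dotProduct, Fin.sum_univ_two, h2]

end AGL

/-! ### The trace of a generator of a quadratic extension -/

theorem FiniteField.generator_add_pow_card_ne_zero {F K : Type*} [Field F] [Finite F] [Field K]
    [Algebra F K] (hK : Module.finrank F K = 2) {β : Kˣ} (hβ : Subgroup.zpowers β = ⊤) :
    (β : K) + (β : K) ^ Nat.card F ≠ 0 := by
  have : Module.Finite F K := Module.finite_of_finrank_pos (by omega)
  have : Finite K := Module.finite_of_finite F
  have hcard : Nat.card K = Nat.card F ^ 2 := by rw [← hK, Module.natCard_eq_pow_finrank (K := F)]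
  have hord : orderOf β = Nat.card F ^ 2 - 1 := by
    rw [orderOf_eq_card_of_zpowers_eq_top hβ, Nat.card_units, hcard]
  obtain ⟨m, hm⟩ : ∃ m, Nat.card F = m + 2 :=
    ⟨Nat.card F - 2, by have := Finite.one_lt_card (α := F); omega⟩
  rw [hm] at hord ⊢
  intro h
  have h1 : (β : K) ^ (m + 1) = -1 := by
    have h0 := β.ne_zero
    apply mul_left_cancel₀ h0
    rw [← pow_succ']
    linear_combination h
  have h2 : β ^ (2 * (m + 1)) = 1 := by
    apply Units.ext
    rw [Units.val_pow_eq_pow_val, mul_comm, pow_mul, h1]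
    simp
  have h3 := Nat.le_of_dvd (by omega) (orderOf_dvd_of_pow_eq_one h2)
  rw [hord] at h3
  have h4 : (m + 2) ^ 2 = m * m + 4 * m + 4 := by ring
  rw [h4] at h3
  have := Nat.zero_le (m * m)
  omega

theorem FiniteField.exists_algebraMap_eq_add_pow_card {F K : Type*} [Field F] [Finite F] [Field K]
    [Algebra F K] (hK : Module.finrank F K = 2) (x : K) :
    ∃ t : F, algebraMap F K t = x + x ^ Nat.card F := by
  have : Module.Finite F K := Module.finite_of_finrank_pos (by omega)
  have : Finite K := Module.finite_of_finite F
  refine ⟨Algebra.trace F K x, ?_⟩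
  rw [FiniteField.algebraMap_trace_eq_sum_pow, hK]
  simp [Finset.sum_range_succ]

theorem mainTheorem5 {F : Type*} [Field F] [Finite F] (q : ℕ) (hq : Nat.card F = q) :
    (3 ≤ q →
      (∃ g h : AGL 2 F, Subgroup.closure {g, h} = ⊤) ∧
      ∀ (K : Type*) [Field K] [Algebra F K], Module.finrank F K = 2 →
      ∀ (α : Fˣ) (β : Kˣ), Subgroup.zpowers α = ⊤ → Subgroup.zpowers β = ⊤ →
        ∃ t : F, algebraMap F K t = (β : K) + (β : K) ^ q ∧
        ∃ A B : GL (Fin 2) F,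
          (A : Matrix (Fin 2) (Fin 2) F) = !![0, -(α : F); 1, t] ∧
          (B : Matrix (Fin 2) (Fin 2) F) = !![(α : F), 0; 0, 1] ∧
          Subgroup.closure {AGL.ofPair A 0, AGL.ofPair B ![0, 1]} = ⊤) ∧
    (q = 2 →
      ∃ A B : GL (Fin 2) F,
        (A : Matrix (Fin 2) (Fin 2) F) = !![0, 1; 1, 1] ∧
        (B : Matrix (Fin 2) (Fin 2) F) = !![1, 1; 0, 1] ∧
        Subgroup.closure {AGL.ofPair A 0, AGL.ofPair B ![1, 0]} = ⊤) := by
  have hex : ∀ (a : Fˣ) (t : F), ∃ A B : GL (Fin 2) F,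
      (A : Matrix (Fin 2) (Fin 2) F) = !![0, -(a : F); 1, t] ∧
      (B : Matrix (Fin 2) (Fin 2) F) = !![(a : F), 0; 0, 1] := fun a t =>
    ⟨Matrix.GeneralLinearGroup.mkOfDetNeZero !![0, -(a : F); 1, t] (by simp [Matrix.det_fin_two]),
      Matrix.GeneralLinearGroup.mkOfDetNeZero !![(a : F), 0; 0, 1] (by simp [Matrix.det_fin_two]),
      rfl, rfl⟩
  subst hq
  refine ⟨fun h3 => ⟨?_, ?_⟩, fun h2 => ?_⟩
  · -- Any nonzero `t` will do; no quadratic extension is needed.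
    obtain ⟨α, hα⟩ := IsCyclic.exists_generator (α := Fˣ)
    obtain ⟨A, B, hA, hB⟩ := hex α 1
    exact ⟨_, _, AGL.closure_companion_diag_eq_top h3 one_ne_zero
      ((Subgroup.eq_top_iff' _).2 hα) hA hB⟩
  · intro K _ _ hK α β hα hβ
    obtain ⟨t, ht⟩ := FiniteField.exists_algebraMap_eq_add_pow_card (F := F) hK (β : K)
    have ht0 : t ≠ 0 := by
      rintro rfl
      rw [map_zero] at ht
      exact FiniteField.generator_add_pow_card_ne_zero hK hβ ht.symm
    obtain ⟨A, B, hA, hB⟩ := hex α t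
    exact ⟨t, ht, A, B, hA, hB, AGL.closure_companion_diag_eq_top h3 ht0 hα hA hB⟩
  · refine ⟨Matrix.GeneralLinearGroup.mkOfDetNeZero !![0, 1; 1, 1] (by simp [Matrix.det_fin_two]),
      Matrix.GeneralLinearGroup.mkOfDetNeZero !![1, 1; 0, 1] (by simp [Matrix.det_fin_two]),
      rfl, rfl, AGL.closure_eq_top_of_card_eq_two h2 rfl rfl⟩
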